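/- Let $X$ be a real vector space (of arbitrary, possibly infinite dimension, with no topology), let $Q\subset X$ be a convex set, and let $F$ be a nonempty subset of $Q$ with $F\neq Q$. Definitions. A nonempty convex subset $F\subset Q$ is a face of $Q$ if, whenever $x,y\in Q$, $\alpha\in(0,1)$ and $\alpha x+(1-\alpha)y\in F$, one has $x,y\in F$; it is a proper face if moreover $F\ne Q$. A cortege of affine functions on $X$ is a set $\mathcal F$ of affine functions $f:X\to\mathbb R$ together with a linear order $\preccurlyeq$ on $\mathcal F$ such that (i) for every $f\in\mathcal F$ the set $E_f=\{x\in X: g(x)=0 \text{ for all } g\in\mathcal F \text{ with } g\preccurlyeq f,\ g\neq f\}$ is nonempty and $f(E_f)=\mathbb R$; (ii) for every $x\in X$ the set $\mathcal F_x=\{f\in\mathcal F: f(x)\neq0\}$ is empty or has a least element $f_x$. A function $u:X\to\mathbb R$ is step-affine if there is a cortege $\mathcal F$ (finite or infinite) such that, for every $x\in X$, $u(x)=0$ if $\mathcal F_x=\varnothing$ and $u(x)=f_x(x)$ otherwise; it is regular if $u(x)=0$ for some $x\in X$. Theorem. $F$ is a proper face of $Q$ if and only if there exists a regular step-affine function $u:X\to\mathbb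 R$ such that $Q\subset\{x\in X: u(x)\ge 0\}$ and $F=\{x\in Q: u(x)=0\}$. -/

import Mathlib

namespace StepAffine

variable {X : Type*} [AddCommGroup X] [Module ℝ X]

/-- `F` is a face of `Q` in the strict sense: a nonempty convex subset of `Q` such that whenever an
interior point of a segment with endpoints in `Q` lies in `F`, both endpoints lie in `F`. -/
structure IsFace (Q F : Set X) : Prop where
  nonempty : F.Nonempty
  convex : Convex ℝ F
  subset : F ⊆ Q
  endpoints_mem : ∀ x ∈ Q, ∀ y ∈ Q, ∀ α : ℝ, 0 < α → α < 1 →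
    α • x + (1 - α) • y ∈ F → x ∈ F ∧ y ∈ F

/-- A proper face: a (nonempty) face different from the whole set. -/
def IsProperFace (Q F : Set X) : Prop :=
  IsFace Q F ∧ F ≠ Q

/-- The set `E_f` of common zeros of the members of `𝓕` strictly preceding `f`; it is the whole
space when `f` is the first member. -/
def precedingZeros (𝓕 : Set (X →ᵃ[ℝ] ℝ)) [LinearOrder 𝓕] (f : 𝓕) : Set X :=
  {x | ∀ g : 𝓕, g ≤ f → g ≠ f → g.1 x = 0}

/-- The subfamily `𝓕_x` of the members of `𝓕` that do not vanish at `x`. -/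
def nonvanishing (𝓕 : Set (X →ᵃ[ℝ] ℝ)) (x : X) : Set 𝓕 :=
  {f | f.1 x ≠ 0}

/-- A linearly ordered family of affine functions is a cortege of affine functions. -/
structure IsCortege (𝓕 : Set (X →ᵃ[ℝ] ℝ)) [LinearOrder 𝓕] : Prop where
  precedingZeros_nonempty : ∀ f : 𝓕, (precedingZeros 𝓕 f).Nonempty
  image_precedingZeros : ∀ f : 𝓕, f.1 '' precedingZeros 𝓕 f = Set.univ
  exists_least : ∀ x : X, nonvanishing 𝓕 x = ∅ ∨ ∃ f, IsLeast (nonvanishing 𝓕 x) f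

/-- `u` is the function `u_𝓕`: it is `0` where all members of `𝓕` vanish, and elsewhere it is the
value of the first member that does not vanish. -/
def IsLexValue (𝓕 : Set (X →ᵃ[ℝ] ℝ)) [LinearOrder 𝓕] (u : X → ℝ) : Prop :=
  ∀ x : X, (nonvanishing 𝓕 x = ∅ → u x = 0) ∧
    ∀ f : 𝓕, IsLeast (nonvanishing 𝓕 x) f → u x = f.1 x

/-- Step-affine functions: those defined by some cortege of affine functions. -/
def IsStepAffine (u : X → ℝ) : Prop :=
  ∃ (𝓕 : Set (X →ᵃ[ℝ] ℝ)) (_ : LinearOrder 𝓕), IsCortege 𝓕 ∧ IsLexValue 𝓕 u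

/-- A step-affine function is regular if it vanishes somewhere. -/
def IsRegularStepAffine (u : X → ℝ) : Prop :=
  IsStepAffine u ∧ {x | u x = 0}.Nonempty

end StepAffine

/-! From a face to a function: let `K` be the cone generated by `Q - F`, and fix `x₀ ∈ F`. The face
property says that a point `x` of `Q` lies in `F` exactly when `x - x₀` is in the lineality space of
`K`. Modulo that space `K` becomes salient, and Zorn's lemma enlarges it to the positive cone of a
total vector order. Each archimedean class of this order carries a functional, obtained by Riesz
extension, that kills all infinitely smaller vectors and detects the sign of vectors of the class.
Ordered from large vectors to small, pulled back to `X` and centred at `x₀`, these functionals form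
the cortege.

Conversely, if `u ≥ 0` on `Q` and `u` vanishes inside a segment of `Q`, then every member of the
cortege vanishes there, so it has opposite signs at the endpoints or vanishes at both. Comparing the
first nonvanishing members at the two endpoints rules out a nonzero value of `u`. -/

/-! ### Extending salient cones to total ones -/

/-- In a real vector space every salient pointed cone is contained in a salient pointed cone `D`
with `D ∪ -D` the whole space. -/
theorem PointedCone.exists_le_salient_total {V : Type*} [AddCommGroup V] [Module ℝ V]
    (C : PointedCone ℝ V) (hC : ∀ x ∈ C, -x ∈ C → x = 0) :
    ∃ D : PointedCone ℝ V, C ≤ D ∧ (∀ x ∈ D, -x ∈ D → x = 0) ∧ ∀ x, x ∈ D ∨ -x ∈ D := by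
  obtain ⟨D, hCD, hD⟩ := zorn_le_nonempty₀ {D : PointedCone ℝ V | ∀ x ∈ D, -x ∈ D → x = 0}
    (by
      intro c hc hchain y hy
      refine ⟨sSup c, ?_, fun z hz => le_sSup hz⟩
      intro x hx hx'
      rw [Submodule.mem_sSup_of_directed ⟨y, hy⟩ hchain.directedOn] at hx hx'
      obtain ⟨A, hA, hxA⟩ := hx
      obtain ⟨B, hB, hxB⟩ := hx'
      rcases hchain.total hA hB with h | h
      · exact hc hB x (h hxA) hxB
      · exact hc hA x hxA (h hxB)) C hC
  refine ⟨D, hCD, hD.prop, fun x => ?_⟩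
  by_contra! hx
  -- Scalars are nonnegative, so the span is a ray. A line in `D` plus this ray puts a positive
  -- multiple of `-x` in `D`, unless the line already lies in `D`.
  have hsal : ∀ y ∈ D ⊔ Submodule.span _ {x}, -y ∈ D ⊔ Submodule.span _ {x} → y = 0 := by
    intro y hy hy'
    simp only [Submodule.mem_sup, Submodule.mem_span_singleton] at hy hy'
    obtain ⟨d, hd, _, ⟨⟨t, ht⟩, rfl⟩, h⟩ := hy
    obtain ⟨e, he, _, ⟨⟨s, hs⟩, rfl⟩, h'⟩ := hy'
    change d + t • x = y at h
    change e + s • x = -y at h'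
    have hsum : d + e = (t + s) • (-x) := by
      have : d + e + (t + s) • x = 0 := by
        rw [add_smul, add_add_add_comm, h, h', add_neg_cancel]
      rw [smul_neg]
      exact eq_neg_of_add_eq_zero_left this
    rcases (add_nonneg ht hs).eq_or_lt with h0 | hpos
    · have ht0 : t = 0 := by linarith
      have hs0 : s = 0 := by linarith
      subst ht0 hs0
      simp only [zero_smul, add_zero] at h h'
      subst h
      exact hD.prop d hd (h' ▸ he)
    · refine absurd ?_ hx.2
      have := D.smul_mem (inv_nonneg.2 hpos.le) (D.add_mem hd he)
      rw [hsum] at this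
      rwa [inv_smul_smul₀ hpos.ne'] at this
  exact hx.1 (hD.le_of_ge hsal le_sup_left
    (Submodule.mem_sup_right (Submodule.mem_span_singleton_self x)))

/-! ### Functionals attached to archimedean classes -/

/-- In a linearly ordered real vector space, every positive `e` admits a linear functional that
vanishes on all elements infinitely small relative to `e` and is positive on the positive elements
of the archimedean class of `e`. -/
theorem ArchimedeanClass.exists_linearMap_real {V : Type*} [AddCommGroup V] [LinearOrder V]
    [IsOrderedAddMonoid V] [Module ℝ V] [IsOrderedModule ℝ V] {e : V} (he : 0 < e) :
    ∃ f : V →ₗ[ℝ] ℝ, (∀ x, ArchimedeanClass.mk e < ArchimedeanClass.mk x → f x = 0) ∧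
      ∀ x, 0 < x → ArchimedeanClass.mk x = ArchimedeanClass.mk e → 0 < f x := by
  let B : Submodule ℝ V := FiniteArchimedeanClass.closedBall ℝ (.mk e he.ne')
  have hmemB : ∀ x, x ∈ B ↔ ArchimedeanClass.mk e ≤ ArchimedeanClass.mk x := by
    intro x
    rw [FiniteArchimedeanClass.mem_closedBall_iff]
    by_cases hx : x = 0
    · simp [hx]
    · exact ⟨fun h => h hx, fun h _ => h⟩
  have heB : e ∈ B := (hmemB e).2 le_rfl
  let e' : B := ⟨e, heB⟩
  have he' : e' ≠ 0 := fun h => he.ne' (congrArg Subtype.val h)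
  let S : PointedCone ℝ B := (PointedCone.positive ℝ V).comap B.subtype
  have hS : ∀ x : B, x ∈ S ↔ 0 ≤ (x : V) := fun x => by simp [S]
  -- A larger class means a smaller vector, so `B` consists of the vectors bounded by a multiple of
  -- `e`. This bound is the cofinality needed to extend `e ↦ 1` positively.
  obtain ⟨g, hg, hgS⟩ := riesz_extension S (LinearPMap.mkSpanSingleton e' (1 : ℝ) he')
    (by
      rintro ⟨x, hx⟩ hxS
      obtain ⟨t, rfl⟩ := Submodule.mem_span_singleton.1 hx
      have h : 0 ≤ t • e := (hS _).1 hxS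
      refine (?_ : (0 : ℝ) ≤ t • 1).trans_eq (LinearPMap.mkSpanSingleton'_apply e' 1 _ t hx).symm
      rw [smul_eq_mul, mul_one]
      by_contra! ht
      exact smul_ne_zero ht.ne he.ne'
        (h.antisymm' (smul_nonpos_of_nonpos_of_nonneg ht.le he.le)))
    (by
      intro y
      obtain ⟨n, hn⟩ := ArchimedeanClass.mk_le_mk.1 ((hmemB y).1 y.2)
      rw [abs_of_pos he] at hn
      refine ⟨⟨n • e', Submodule.smul_of_tower_mem _ n (Submodule.mem_span_singleton_self e')⟩,
        (hS _).2 ?_⟩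
      have := (neg_le_abs (y : V)).trans hn
      change 0 ≤ n • e + (y : V)
      rwa [← neg_le_iff_add_nonneg])
  have hge : g e' = 1 := by
    have := hg ⟨e', Submodule.mem_span_singleton_self e'⟩
    rw [this]
    exact LinearPMap.mkSpanSingleton_apply ℝ ℝ he' _
  have hmono : ∀ x y : B, (x : V) ≤ y → g x ≤ g y := by
    intro x y hxy
    have := hgS (y - x) ((hS _).2 (sub_nonneg.2 hxy))
    rw [map_sub] at this
    linarith
  -- Values outside `B` are irrelevant: both claims concern vectors of `B` only.
  obtain ⟨f, hf⟩ := LinearMap.exists_extend g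
  have hfg : ∀ x : B, f x = g x := fun x => congrArg (fun h => h x) hf
  refine ⟨f, fun x hx => ?_, fun x hx hxe => ?_⟩
  · have hxB : x ∈ B := (hmemB x).2 hx.le
    rw [hfg ⟨x, hxB⟩]
    have hbound : ∀ n : ℕ, n * |g ⟨x, hxB⟩| ≤ 1 := by
      intro n
      have h := (ArchimedeanClass.mk_lt_mk.1 hx n).le
      rw [abs_of_pos he, ← abs_nsmul] at h
      have h1 := hmono (n • ⟨x, hxB⟩) e' ((le_abs_self _).trans h)
      have h2 := hmono (-(n • ⟨x, hxB⟩)) e' ((neg_le_abs _).trans h)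
      rw [hge] at h1 h2
      rw [map_neg] at h2
      rw [map_nsmul, nsmul_eq_mul] at h1 h2
      rw [← Nat.abs_cast n, ← abs_mul]
      exact abs_le.2 ⟨by linarith, h1⟩
    by_contra hne
    obtain ⟨n, hn⟩ := exists_nat_gt (|g ⟨x, hxB⟩|⁻¹)
    have hpos := abs_pos.2 hne
    have := mul_lt_mul_of_pos_right hn hpos
    rw [inv_mul_cancel₀ hpos.ne'] at this
    exact absurd (hbound n) (not_le.2 this)
  · have hxB : x ∈ B := (hmemB x).2 hxe.ge
    rw [hfg ⟨x, hxB⟩]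
    obtain ⟨n, hn⟩ := ArchimedeanClass.mk_le_mk.1 hxe.le
    rw [abs_of_pos he, abs_of_pos hx] at hn
    have h1 := hmono e' (n • ⟨x, hxB⟩) hn
    rw [hge, map_nsmul, nsmul_eq_mul] at h1
    by_contra! hle
    nlinarith [(Nat.cast_nonneg n : (0 : ℝ) ≤ n)]

namespace StepAffine

/-! ### Corteges given by indexed families -/

/-- An indexed form of the construction of step-affine functions. -/
theorem exists_isStepAffine_of_family {X ι : Type*} [AddCommGroup X] [Module ℝ X] [LinearOrder ι]
    (φ : ι → X →ᵃ[ℝ] ℝ)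
    (hsurj : ∀ i, φ i '' {x | ∀ j < i, φ j x = 0} = Set.univ)
    (hleast : ∀ x, (∀ i, φ i x = 0) ∨ ∃ i, φ i x ≠ 0 ∧ ∀ j < i, φ j x = 0) :
    ∃ u : X → ℝ, IsStepAffine u ∧ (∀ x, (∀ i, φ i x = 0) → u x = 0) ∧
      ∀ x i, φ i x ≠ 0 → (∀ j < i, φ j x = 0) → u x = φ i x := by
  classical
  -- Where all earlier members vanish, `φ i` still takes the value 1. Hence `φ` is injective and its
  -- range inherits the order of `ι`.
  have hne : ∀ i j, j < i → φ j ≠ φ i := by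
    intro i j hji heq
    obtain ⟨x, hx, hx1⟩ := (hsurj i).ge (Set.mem_univ (1 : ℝ))
    have := hx j hji
    rw [heq, hx1] at this
    exact one_ne_zero this
  have hinj : Function.Injective φ := by
    intro i j hij
    rcases lt_trichotomy i j with h | h | h
    · exact absurd hij (hne _ _ h)
    · exact h
    · exact absurd hij.symm (hne _ _ h)
  let E : ι ≃ Set.range φ := Equiv.ofInjective φ hinj
  let _ : LinearOrder (Set.range φ) := LinearOrder.lift' E.symm E.symm.injective
  have hEle : ∀ i j, E i ≤ E j ↔ i ≤ j := by
    intro i j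
    change E.symm (E i) ≤ E.symm (E j) ↔ i ≤ j
    simp
  have hEφ : ∀ i, (E i).1 = φ i := fun i => rfl
  have hprec : ∀ i, precedingZeros (Set.range φ) (E i) = {x | ∀ j < i, φ j x = 0} := by
    intro i
    ext x
    refine E.surjective.forall.trans (forall_congr' fun j => ?_)
    rw [hEle, hEφ, E.injective.ne_iff, lt_iff_le_and_ne, and_imp]
  have hleastE : ∀ x i, φ i x ≠ 0 → (∀ j < i, φ j x = 0) →
      IsLeast (nonvanishing (Set.range φ) x) (E i) := by
    intro x i hi hj
    refine ⟨hi, fun g hg => ?_⟩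
    obtain ⟨j, rfl⟩ := E.surjective g
    rw [hEle]
    by_contra! hlt
    exact hg (hj j hlt)
  have hempty : ∀ x, (∀ i, φ i x = 0) → nonvanishing (Set.range φ) x = ∅ := by
    intro x hx
    refine Set.eq_empty_of_forall_notMem fun g hg => ?_
    obtain ⟨j, rfl⟩ := E.surjective g
    exact hg (hx j)
  let u : X → ℝ := fun x => if h : ∃ i, φ i x ≠ 0 ∧ ∀ j < i, φ j x = 0 then φ h.choose x else 0
  have hu0 : ∀ x, (∀ i, φ i x = 0) → u x = 0 := by
    intro x hx
    exact dif_neg fun ⟨i, hi, _⟩ => hi (hx i)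
  have hu : ∀ x i, φ i x ≠ 0 → (∀ j < i, φ j x = 0) → u x = φ i x := by
    intro x i hi hj
    have h : ∃ i, φ i x ≠ 0 ∧ ∀ j < i, φ j x = 0 := ⟨i, hi, hj⟩
    have hEq : E h.choose = E i :=
      (hleastE x _ h.choose_spec.1 h.choose_spec.2).unique (hleastE x i hi hj)
    rw [show u x = φ h.choose x from dif_pos h, E.injective hEq]
  refine ⟨u, ⟨Set.range φ, inferInstance, ⟨?_, ?_, ?_⟩, ?_⟩, hu0, hu⟩
  · intro f
    obtain ⟨i, rfl⟩ := E.surjective f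
    rw [hprec]
    obtain ⟨x, hx, -⟩ := (hsurj i).ge (Set.mem_univ (1 : ℝ))
    exact ⟨x, hx⟩
  · intro f
    obtain ⟨i, rfl⟩ := E.surjective f
    rw [hprec]
    exact hsurj i
  · intro x
    rcases hleast x with h | ⟨i, hi, hj⟩
    · exact .inl (hempty x h)
    · exact .inr ⟨E i, hleastE x i hi hj⟩
  · intro x
    refine ⟨fun h => hu0 x fun i => ?_, fun f hf => ?_⟩
    · by_contra hi
      exact h.subset (show E i ∈ nonvanishing (Set.range φ) x from hi)
    · obtain ⟨i, rfl⟩ := E.surjective f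
      refine hu x i hf.1 fun j hj => ?_
      by_contra hne
      exact not_le.2 hj ((hEle i j).1 (hf.2 (show E j ∈ nonvanishing (Set.range φ) x from hne)))

/-! ### Step-affine functions from linear orders -/

/-- A linear map `π` to a linearly ordered real vector space and a point `x₀` give a regular
step-affine function with the sign of `π x - π x₀`. -/
theorem exists_isRegularStepAffine_of_linearMap {X V : Type*} [AddCommGroup X] [Module ℝ X]
    [AddCommGroup V] [LinearOrder V] [IsOrderedAddMonoid V] [Module ℝ V] [IsOrderedModule ℝ V]
    (π : X →ₗ[ℝ] V) (hπ : Function.Surjective π) (x₀ : X) :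
    ∃ u : X → ℝ, IsRegularStepAffine u ∧ (∀ x, π x = π x₀ → u x = 0) ∧
      ∀ x, π x₀ < π x → 0 < u x := by
  have hclass : ∀ c : FiniteArchimedeanClass V, ∃ f : V →ₗ[ℝ] ℝ,
      (∀ x, c.1 < ArchimedeanClass.mk x → f x = 0) ∧
      ∀ x, 0 < x → ArchimedeanClass.mk x = c.1 → 0 < f x := by
    intro c
    induction c using FiniteArchimedeanClass.ind with
    | mk a ha =>
      obtain ⟨f, hf, hf'⟩ := ArchimedeanClass.exists_linearMap_real (abs_pos.2 ha)
      rw [ArchimedeanClass.mk_abs] at hf hf'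
      exact ⟨f, hf, hf'⟩
  choose f hf0 hfpos using hclass
  have hfne : ∀ c x, ArchimedeanClass.mk x = (c : FiniteArchimedeanClass V).1 → f c x ≠ 0 := by
    intro c x hx
    have hx0 : x ≠ 0 := by
      rintro rfl
      exact c.2 (hx.symm.trans (ArchimedeanClass.mk_eq_top_iff.2 rfl))
    rcases hx0.lt_or_gt with h | h
    · have := hfpos c (-x) (neg_pos.2 h) (by rw [ArchimedeanClass.mk_neg, hx])
      rw [map_neg] at this
      exact (neg_pos.1 this).ne
    · exact (hfpos c x h hx).ne'
  let φ : FiniteArchimedeanClass V → X →ᵃ[ℝ] ℝ := fun c =>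
    (f c ∘ₗ π).toAffineMap - AffineMap.const ℝ X (f c (π x₀))
  have hφ : ∀ c x, φ c x = f c (π x - π x₀) := by
    intro c x
    simp [φ]
  obtain ⟨u, hu, hu0, hval⟩ := exists_isStepAffine_of_family φ
    (by
      intro c
      refine Set.eq_univ_of_forall fun r => ?_
      obtain ⟨a, ha⟩ : ∃ a : V, ArchimedeanClass.mk a = c.1 := by
        induction c using FiniteArchimedeanClass.ind with
        | mk a ha => exact ⟨a, rfl⟩
      -- A multiple of `a` is infinitely small relative to every earlier class, so only the value at
      -- `c` needs adjusting.
      obtain ⟨x, hx⟩ := hπ ((r / f c a) • a + π x₀)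
      refine ⟨x, fun j hj => ?_, ?_⟩
      · rw [hφ, hx, add_sub_cancel_right, map_smul, hf0 j a (ha ▸ hj), smul_zero]
      · rw [hφ, hx, add_sub_cancel_right, map_smul, smul_eq_mul, div_mul_cancel₀ _ (hfne c a ha)])
    (by
      intro x
      by_cases hx : π x - π x₀ = 0
      · exact .inl fun i => by rw [hφ, hx, map_zero]
      -- The first nonvanishing member is the one attached to the class of `π x - π x₀`.
      · refine .inr ⟨.mk _ hx, ?_, fun j hj => ?_⟩
        · rw [hφ]
          exact hfne _ _ rfl
        · rw [hφ]
          exact hf0 j _ hj)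
  have hzero : ∀ x, π x = π x₀ → u x = 0 := fun x hx =>
    hu0 x fun i => by rw [hφ, hx, sub_self, map_zero]
  refine ⟨u, ⟨hu, x₀, hzero x₀ rfl⟩, hzero, fun x hx => ?_⟩
  have hpos : 0 < π x - π x₀ := sub_pos.2 hx
  have h := hfpos (.mk _ hpos.ne') _ hpos rfl
  rw [hval x (.mk _ hpos.ne') (by rw [hφ]; exact h.ne')
    (fun j hj => by rw [hφ]; exact hf0 j _ hj), hφ]
  exact h

/-- A pointed cone gives a regular step-affine function, nonnegative on the translate of
the cone by `x₀`, and vanishing there exactly on the translate of the lineality space. -/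
theorem exists_isRegularStepAffine_of_cone {X : Type*} [AddCommGroup X] [Module ℝ X]
    (K : PointedCone ℝ X) (x₀ : X) :
    ∃ u : X → ℝ, IsRegularStepAffine u ∧
      ∀ x, x - x₀ ∈ K → 0 ≤ u x ∧ (u x = 0 ↔ x - x₀ ∈ K.lineal) := by
  classical
  let π : X →ₗ[ℝ] X ⧸ K.lineal := K.lineal.mkQ
  obtain ⟨D, hKD, hsal, htot⟩ := PointedCone.exists_le_salient_total (K.map π) (by
    rintro _ ⟨a, ha, rfl⟩ ⟨b, hb, hab⟩
    change π b = -π a at hab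
    change π a = 0
    -- Salience of the image: `-a = b - (a + b)` is then in `K`, so `a` is in the lineality space.
    have hm : a + b ∈ K.lineal := by
      rw [← Submodule.Quotient.mk_eq_zero]
      change π (a + b) = 0
      rw [map_add, hab, add_neg_cancel]
    refine (Submodule.Quotient.mk_eq_zero _).2 (PointedCone.mem_lineal.2 ⟨ha, ?_⟩)
    have := K.add_mem hb (PointedCone.mem_lineal.1 hm).2
    rwa [neg_add, add_comm, add_assoc, neg_add_cancel, add_zero] at this)
  let A : AddGroupCone (X ⧸ K.lineal) :=
    { D.toAddSubmonoid with eq_zero_of_mem_of_neg_mem' := fun ha hb => hsal _ ha hb }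
  have : HasMemOrNegMem A := ⟨htot⟩
  let _ : LinearOrder (X ⧸ K.lineal) := LinearOrder.mkOfAddGroupCone A
  have : IsOrderedAddMonoid (X ⧸ K.lineal) := IsOrderedAddMonoid.mkOfCone A
  have hle : ∀ a b : X ⧸ K.lineal, a ≤ b ↔ b - a ∈ D := fun a b => Iff.rfl
  have : IsOrderedModule ℝ (X ⧸ K.lineal) := IsOrderedModule.of_smul_nonneg (by
    intro r hr b hb
    rw [hle, sub_zero] at hb ⊢
    exact D.smul_mem hr hb)
  obtain ⟨u, hu, hu0, hupos⟩ :=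
    exists_isRegularStepAffine_of_linearMap π K.lineal.mkQ_surjective x₀
  refine ⟨u, hu, fun x hx => ?_⟩
  have hπ : π x₀ ≤ π x := by
    rw [hle, ← map_sub]
    exact hKD ⟨x - x₀, hx, rfl⟩
  have hmem : x - x₀ ∈ K.lineal ↔ π x = π x₀ := (Submodule.Quotient.eq _).symm
  rw [hmem]
  rcases hπ.eq_or_lt with h | h
  · exact ⟨(hu0 x h.symm).ge, fun _ => h.symm, fun _ => hu0 x h.symm⟩
  · exact ⟨(hupos x h).le, fun h0 => absurd h0 (hupos x h).ne', fun h0 => absurd h0.symm h.ne⟩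

/-! ### Faces -/

/-- Every face of a convex set is cut out by a regular step-affine function. -/
theorem IsFace.exists_isRegularStepAffine {X : Type*} [AddCommGroup X] [Module ℝ X] {Q F : Set X}
    (hQ : Convex ℝ Q) (hF : IsFace Q F) :
    ∃ u : X → ℝ, IsRegularStepAffine u ∧ Q ⊆ {x | 0 ≤ u x} ∧ F = {x ∈ Q | u x = 0} := by
  open scoped Pointwise in
  obtain ⟨x₀, hx₀⟩ := hF.nonempty
  have hconv : Convex ℝ (Q - F) := hQ.sub hF.convex
  have hsub : ∀ x ∈ Q, ∀ y ∈ F, x - y ∈ ConvexCone.hull ℝ (Q - F) :=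
    fun x hx y hy => ConvexCone.subset_hull (Set.sub_mem_sub hx hy)
  have h0 : (ConvexCone.hull ℝ (Q - F)).Pointed := by
    have := hsub x₀ (hF.subset hx₀) x₀ hx₀
    rwa [sub_self] at this
  obtain ⟨u, hu, hK⟩ :=
    exists_isRegularStepAffine_of_cone ((ConvexCone.hull ℝ (Q - F)).toPointedCone h0) x₀
  refine ⟨u, hu, fun x hx => (hK x (hsub x hx x₀ hx₀)).1, Set.ext fun x => ⟨fun hx => ?_, ?_⟩⟩
  · have hxQ := hF.subset hx
    refine ⟨hxQ, (hK x (hsub x hxQ x₀ hx₀)).2.2 (PointedCone.mem_lineal.2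
      ⟨hsub x hxQ x₀ hx₀, ?_⟩)⟩
    rw [neg_sub]
    exact hsub x₀ (hF.subset hx₀) x hx
  · rintro ⟨hxQ, hux⟩
    have hlin := ((hK x (hsub x hxQ x₀ hx₀)).2.1 hux).2
    -- Here `x₀ - x = t • (q - y)`, that is `x + t • q = x₀ + t • y`. Dividing by `1 + t` exhibits a
    -- point of `F` inside the segment from `x` to `q`.
    obtain ⟨t, ht, _, ⟨q, hq, y, hy, rfl⟩, heq⟩ := (ConvexCone.mem_hull_of_convex hconv).1 hlin
    have ht1 : (0 : ℝ) < 1 + t := by linarith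
    have hα1 : (1 + t)⁻¹ < 1 := inv_lt_one_of_one_lt₀ (by linarith)
    have hα0 : 0 < (1 + t)⁻¹ := inv_pos.2 ht1
    have h1α : 1 - (1 + t)⁻¹ = (1 + t)⁻¹ * t := by field_simp; ring
    have hcomb : (1 + t)⁻¹ • x + (1 - (1 + t)⁻¹) • q
        = (1 + t)⁻¹ • x₀ + (1 - (1 + t)⁻¹) • y := by
      have : x + t • q = x₀ + t • y := by
        have heq' : t • q - t • y = x₀ - x := by simpa [smul_sub] using heq
        rw [sub_eq_sub_iff_add_eq_add] at heq'
        rw [add_comm x, heq']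
      rw [h1α, mul_smul, mul_smul, ← smul_add, ← smul_add, this]
    refine (hF.endpoints_mem x hxQ q hq _ hα0 hα1 ?_).1
    rw [hcomb]
    exact hF.convex hx₀ hy hα0.le (by linarith) (by ring)

/-- The zeros of a step-affine function are the common zeros of its cortege. -/
theorem IsLexValue.eq_zero_iff {X : Type*} [AddCommGroup X] [Module ℝ X]
    {𝓕 : Set (X →ᵃ[ℝ] ℝ)} [LinearOrder 𝓕] (h𝓕 : IsCortege 𝓕) {u : X → ℝ} (hu : IsLexValue 𝓕 u)
    (x : X) : u x = 0 ↔ ∀ f : 𝓕, f.1 x = 0 := by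
  constructor
  · intro h f
    by_contra hf
    rcases h𝓕.exists_least x with hx | ⟨g, hg⟩
    · exact hx.subset (show f ∈ nonvanishing 𝓕 x from hf)
    · exact hg.1 (((hu x).2 g hg).symm.trans h)
  · intro h
    exact (hu x).1 (Set.eq_empty_of_forall_notMem fun f hf => hf (h f))

/-- A step-affine function nonnegative on a convex set vanishes on a face of it. -/
theorem IsStepAffine.isFace {X : Type*} [AddCommGroup X] [Module ℝ X] {Q F : Set X}
    (hQ : Convex ℝ Q) (hFne : F.Nonempty) {u : X → ℝ} (hu : IsStepAffine u)
    (hQu : Q ⊆ {x | 0 ≤ u x}) (hFu : F = {x ∈ Q | u x = 0}) : IsFace Q F := by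
  obtain ⟨𝓕, _, h𝓕, hlex⟩ := hu
  have hzero := hlex.eq_zero_iff h𝓕
  have hcomb : ∀ (f : X →ᵃ[ℝ] ℝ) (x y : X) (a b : ℝ), a + b = 1 →
      f (a • x + b • y) = a * f x + b * f y := fun f x y a b hab => by
    simpa using Convex.combo_affine_apply (f := f) (x := x) (y := y) hab
  have hfirst : ∀ x ∈ Q, u x ≠ 0 → ∃ f : 𝓕, 0 < f.1 x ∧ ∀ g < f, g.1 x = 0 := by
    intro x hx hne
    rcases h𝓕.exists_least x with h | ⟨f, hf⟩
    · exact absurd ((hlex x).1 h) hne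
    · refine ⟨f, (hlex x).2 f hf ▸ lt_of_le_of_ne (hQu hx) hne.symm, fun g hg => ?_⟩
      by_contra h
      exact not_le.2 hg (hf.2 h)
  have hend : ∀ x ∈ Q, ∀ y ∈ Q, ∀ a b : ℝ, 0 < a → 0 < b → a + b = 1 →
      u (a • x + b • y) = 0 → u x = 0 := by
    intro x hx y hy a b ha hb hab h
    by_contra hux
    obtain ⟨f, hf, hflt⟩ := hfirst x hx hux
    have key : ∀ k : 𝓕, a * k.1 x + b * k.1 y = 0 := fun k => by
      rw [← hcomb k.1 x y a b hab]
      exact (hzero _).1 h k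
    have hfy : f.1 y < 0 := by nlinarith [key f, mul_pos ha hf]
    have huy : u y ≠ 0 := fun h0 => hfy.ne ((hzero y).1 h0 f)
    obtain ⟨g, hg, hglt⟩ := hfirst y hy huy
    -- The smaller of `f` and `g` vanishes at the endpoint where the other is first, hence by `key`
    -- at both endpoints; if they coincide, the signs at `y` clash.
    rcases lt_trichotomy f g with hlt | rfl | hlt
    · exact hfy.ne (hglt f hlt)
    · exact lt_asymm hg hfy
    · have := key g
      rw [hflt g hlt] at this
      nlinarith [mul_pos hb hg]
  refine ⟨hFne, ?_, ?_, ?_⟩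
  · subst hFu
    intro x hx y hy a b ha hb hab
    refine ⟨hQ hx.1 hy.1 ha hb hab, (hzero _).2 fun f => ?_⟩
    rw [hcomb f.1 x y a b hab, (hzero x).1 hx.2, (hzero y).1 hy.2]
    simp
  · subst hFu
    exact fun x hx => hx.1
  · intro x hx y hy a ha ha1 h
    subst hFu
    refine ⟨⟨hx, hend x hx y hy a (1 - a) ha (by linarith) (by ring) h.2⟩,
      ⟨hy, hend y hy x hx (1 - a) a (by linarith) ha (by ring) ?_⟩⟩
    rw [add_comm]
    exact h.2

end StepAffine

theorem theorem3 {X : Type*} [AddCommGroup X] [Module ℝ X] (Q F : Set X) (hQ : Convex ℝ Q)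
    (hFne : F.Nonempty) (hFQ : F ⊆ Q) (hF : F ≠ Q) :
    StepAffine.IsProperFace Q F ↔
      ∃ u : X → ℝ, StepAffine.IsRegularStepAffine u ∧
        Q ⊆ {x | 0 ≤ u x} ∧ F = {x ∈ Q | u x = 0} :=
  ⟨fun h => h.1.exists_isRegularStepAffine hQ,
    fun ⟨_, hu, hQu, hFu⟩ => ⟨hu.1.isFace hQ hFne hQu hFu, hF⟩⟩
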